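/- Let $E$ be a real Banach lattice with order continuous norm, that is, $\|x_\alpha\|\to 0$ for every net $x_\alpha\downarrow 0$ in $E$. The following are equivalent: (1) $E$ is a KB-space, i.e. every norm bounded monotone sequence in $E$ is norm convergent; (2) every norm bounded uo-Cauchy sequence in $E$ is uo-convergent; (3) every statistically norm bounded st-uo-Cauchy sequence in $E$ is st-uo-convergent. Here the following definitions are used. A net $(x_\alpha)_{\alpha\in D}$ is order convergent to $x$ if there is a net $(p_\alpha)_{\alpha\in D}$ with $p_\alpha\downarrow 0$ and $|x_\alpha-x|\le p_\alpha$ for all $\alpha$. It is uo-convergent to $x$ if $|x_\alpha-x|\wedge u$ is order convergent to $0$ for every $u\in E_+$. Let $D$ be a directed set in which $D_\alpha=\{\beta\in D:\beta\le\alpha\}$ is finite for every $\alpha$; only $D=\mathbb N$ and $D=\mathbb N\times\mathbb N$ with the product order are needed. The density of $A\subseteq D$ is $\delta(A)=\lim_{\alpha\in D}|A\cap D_\alpha|/|D_\alpha|$ (for $D=\mathbb N$ this is the natural density). For a net $(p_\alpha)_{\alpha\in D}$ write $p_\alpha\downarrow^{st}0$ if there is $K\subseteq D$ with $\delta(K)=1$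 such that $p$ is decreasing on $K$ and $\inf_{\alpha\in K}p_\alpha=0$. A net $(x_\alpha)_{\alpha\in D}$ is statistically order convergent to $x$ if there is $p_\alpha\downarrow^{st}0$ with $|x_\alpha-x|\le p_\alpha$ for all $\alpha$. It is st-uo-convergent to $x$ if $|x_\alpha-x|\wedge u$ is statistically order convergent to $0$ for every $u\in E_+$. A sequence $(x_n)$ is uo-Cauchy (respectively st-uo-Cauchy) if the net $(x_m-x_n)_{(m,n)\in\mathbb N\times\mathbb N}$ is uo-convergent (respectively st-uo-convergent) to $0$. It is statistically norm bounded if for every $C>0$ there is $\lambda>0$ with $\delta(\{n:\|\lambda x_n\|>C\})=0$. -/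

import Mathlib

open Filter Topology

universe u v

/-- The norm of `E` is order continuous: `‖x_α‖ → 0` for every net `x_α ↓ 0`.
Index sets in the universe of `E` suffice, because a decreasing net may be replaced by its range,
directed by the reversed order of `E`. -/
def IsOrderContinuousNorm (E : Type u) [NormedAddCommGroup E] [Lattice E] : Prop :=
  ∀ (ι : Type u) [Preorder ι] [IsDirectedOrder ι] [Nonempty ι] (x : ι → E),
    Antitone x → IsGLB (Set.range x) 0 → Tendsto (fun i => ‖x i‖) atTop (𝓝 0)

/-- A KB-space: every norm bounded monotone sequence is norm convergent. -/
def IsKBSpace (E : Type u) [NormedAddCommGroup E] [Lattice E] : Prop :=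
  ∀ x : ℕ → E, (Monotone x ∨ Antitone x) → (∃ C : ℝ, ∀ n, ‖x n‖ ≤ C) →
    ∃ l : E, Tendsto x atTop (𝓝 l)

section RieszSpace

variable {D : Type v} {E : Type u} [Lattice E] [AddCommGroup E]

/-- Order convergence of the net `x` to `l`: `|x_α - l| ≤ p_α` for some net `p_α ↓ 0`. -/
def OrderConvergesTo [Preorder D] (x : D → E) (l : E) : Prop :=
  ∃ p : D → E, Antitone p ∧ IsGLB (Set.range p) 0 ∧ ∀ a, |x a - l| ≤ p a

/-- Unbounded order convergence of the net `x` to `l`. -/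
def UOConvergesTo [Preorder D] (x : D → E) (l : E) : Prop :=
  ∀ w : E, 0 ≤ w → OrderConvergesTo (fun a => |x a - l| ⊓ w) 0

/-- A sequence is uo-Cauchy if the net of differences `x_m - x_n`, indexed by the pairs `(m, n)`
with the product order, is uo-convergent to `0`. -/
def IsUOCauchySeq (x : ℕ → E) : Prop :=
  UOConvergesTo (fun q : ℕ × ℕ => x q.1 - x q.2) 0

end RieszSpace

/-- `A ⊆ D` has asymptotic density `d`: the ratios `|A ∩ D_α| / |D_α|`, where
`D_α = {β | β ≤ α}`, tend to `d` along `D`. For `D = ℕ` this is the natural density. -/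
def HasDensity {D : Type v} [Preorder D] [LocallyFiniteOrderBot D] (A : Set D) (d : ℝ) : Prop :=
  Tendsto (fun a : D => ((A ∩ Set.Iic a).ncard : ℝ) / ((Set.Iic a).ncard : ℝ)) atTop (𝓝 d)

section Statistical

variable {D : Type v} [Preorder D] [LocallyFiniteOrderBot D]

/-- `p ↓ l` statistically: `p` is decreasing with infimum `l` along an index set of density one. -/
def StatDecreasesTo {E : Type u} [Lattice E] (p : D → E) (l : E) : Prop :=
  ∃ K : Set D, HasDensity K 1 ∧ AntitoneOn p K ∧ IsGLB (p '' K) l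

/-- Statistical order convergence. -/
def StatOrderConvergesTo {E : Type u} [Lattice E] [AddCommGroup E] (x : D → E) (l : E) : Prop :=
  ∃ p : D → E, StatDecreasesTo p 0 ∧ ∀ a, |x a - l| ≤ p a

/-- Statistical unbounded order convergence. -/
def StatUOConvergesTo {E : Type u} [Lattice E] [AddCommGroup E] (x : D → E) (l : E) : Prop :=
  ∀ w : E, 0 ≤ w → StatOrderConvergesTo (fun a => |x a - l| ⊓ w) 0

/-- Statistical norm boundedness. -/
def IsStatNormBounded {E : Type u} [NormedAddCommGroup E] [NormedSpace ℝ E] (x : D → E) : Prop :=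
  ∀ C : ℝ, 0 < C → ∃ r : ℝ, 0 < r ∧ HasDensity {a | C < ‖r • x a‖} 0

end Statistical

/-- A sequence is st-uo-Cauchy if the net of differences `x_m - x_n`, indexed by the pairs `(m, n)`
with the product order, is st-uo-convergent to `0`. -/
def IsStatUOCauchySeq {E : Type u} [Lattice E] [AddCommGroup E] (x : ℕ → E) : Prop :=
  StatUOConvergesTo (fun q : ℕ × ℕ => x q.1 - x q.2) 0

/-!
Order convergence and statistical order convergence are one notion with a parameter, a filter `F` on
the index set: the dominating net has to decrease to zero on some member of `F`. It is `⊤` in the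
first case and the filter `densityOne` in the second (`OrderConvergesAlong`). As the norm is
order continuous, "decreasing with infimum zero" means "decreasing and null in norm"
(`IsOrderContinuousNorm.orderConvergesAlong_iff`), so limits may be identified in norm.

**From KB to completeness.** Passing to positive and negative parts, let `x n ≥ 0` be norm bounded
and uo-Cauchy. Each truncation `x n ⊓ w` is order Cauchy, hence converges in order, to `y_w` say.
The `y_w` form a norm bounded increasing net, which converges in a KB-space, to `y`, and
`y_w = y ⊓ w` (`IsKBSpace.exists_tendsto_inf`). Since `|x n - y| ⊓ w ≤ |x n ⊓ (y + w) - y|`, the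
sequence is uo-convergent to `y` (`exists_uoConvergesAlong`). That order Cauchy sequences converge
is easy for `⊤` (`exists_orderConvergesAlong_top`). In the statistical case
(`exists_orderConvergesAlong_densityOne`) the Cauchy condition holds on a set of density one in
`ℕ × ℕ` and has to be transferred to a set of density one in `ℕ`; this is a counting argument
(`exists_densityOne_pairwise_linked`) followed by a diagonal argument
(`exists_diagonal_mem_densityOne`).

**From completeness to KB.** A norm bounded increasing sequence is uo-Cauchy
(`IsOrderContinuousNorm.uoCauchy_of_monotone`): otherwise infinitely many of its successive
increments would almost dominate one fixed nonzero positive element. If it is uo-convergent, even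
only statistically, then its limit is an upper bound, the truncation is superfluous, and the
sequence converges in norm (`UOConvergesAlong.tendsto_of_monotone`).
-/

/-! ### The filter of sets of density one -/

section Density

variable {D : Type v} [Preorder D] [LocallyFiniteOrderBot D]

lemma ncard_Iic_pos (a : D) : 0 < ((Set.Iic a).ncard : ℝ) := by
  exact_mod_cast (Set.ncard_pos (Set.finite_Iic a)).2 Set.nonempty_Iic

/-- Density zero in terms of counts, without division. -/
lemma hasDensity_zero_iff {A : Set D} :
    HasDensity A 0 ↔
      ∀ η : ℝ, 0 < η → ∀ᶠ a in atTop, ((A ∩ Set.Iic a).ncard : ℝ) ≤ η * (Set.Iic a).ncard := by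
  constructor
  · intro h η hη
    filter_upwards [h.eventually (eventually_le_nhds hη)] with a ha
    rwa [div_le_iff₀ (ncard_Iic_pos a)] at ha
  · intro h
    refine Metric.tendsto_nhds.2 fun ε hε => ?_
    filter_upwards [h (ε / 2) (half_pos hε)] with a ha
    rw [← div_le_iff₀ (ncard_Iic_pos a)] at ha
    rw [Real.dist_0_eq_abs, abs_of_nonneg (by positivity)]
    linarith

lemma hasDensity_one_iff_compl {A : Set D} : HasDensity A 1 ↔ HasDensity Aᶜ 0 := by
  have key : ∀ a : D, ((Aᶜ ∩ Set.Iic a).ncard : ℝ) / (Set.Iic a).ncard =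
      1 - ((A ∩ Set.Iic a).ncard : ℝ) / (Set.Iic a).ncard := by
    intro a
    have h := Set.ncard_inter_add_ncard_sdiff_eq_ncard (Set.Iic a) A (Set.finite_Iic a)
    rw [Set.sdiff_eq, Set.inter_comm _ A, Set.inter_comm _ Aᶜ] at h
    rw [eq_sub_iff_add_eq, ← add_div, div_eq_one_iff_eq (ncard_Iic_pos a).ne', ← h]
    push_cast
    ring
  simp only [HasDensity, key]
  constructor
  · intro h
    simpa using h.const_sub 1
  · intro h
    simpa using h.const_sub 1

lemma hasDensity_zero_mono {A B : Set D} (hAB : A ⊆ B) (hB : HasDensity B 0) :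
    HasDensity A 0 := by
  rw [hasDensity_zero_iff] at *
  intro η hη
  filter_upwards [hB η hη] with a ha
  refine le_trans ?_ ha
  exact_mod_cast Set.ncard_le_ncard (Set.inter_subset_inter_left _ hAB)
    ((Set.finite_Iic a).inter_of_right _)

lemma hasDensity_zero_union {A B : Set D} (hA : HasDensity A 0) (hB : HasDensity B 0) :
    HasDensity (A ∪ B) 0 := by
  rw [hasDensity_zero_iff] at *
  intro η hη
  filter_upwards [hA _ (half_pos hη), hB _ (half_pos hη)] with a ha hb
  have h : (((A ∪ B) ∩ Set.Iic a).ncard : ℝ) ≤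
      (A ∩ Set.Iic a).ncard + (B ∩ Set.Iic a).ncard := by
    rw [Set.union_inter_distrib_right]
    exact_mod_cast Set.ncard_union_le _ _
  linarith

variable (D) in
/-- The filter of subsets of `D` of asymptotic density one. -/
def densityOne : Filter D where
  sets := {A | HasDensity A 1}
  univ_sets := by
    simp only [Set.mem_ofPred_eq, hasDensity_one_iff_compl, Set.compl_univ]
    simpa [HasDensity] using tendsto_const_nhds
  sets_of_superset hA hAB := by
    rw [Set.mem_ofPred_eq, hasDensity_one_iff_compl] at *
    exact hasDensity_zero_mono (Set.compl_subset_compl.2 hAB) hA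
  inter_sets hA hB := by
    rw [Set.mem_ofPred_eq, hasDensity_one_iff_compl] at *
    rw [Set.compl_inter]
    exact hasDensity_zero_union hA hB

lemma mem_densityOne {A : Set D} : A ∈ densityOne D ↔ HasDensity A 1 := Iff.rfl

lemma mem_densityOne_iff {A : Set D} : A ∈ densityOne D ↔
    ∀ η : ℝ, 0 < η → ∀ᶠ a in atTop, ((Aᶜ ∩ Set.Iic a).ncard : ℝ) ≤ η * (Set.Iic a).ncard := by
  rw [mem_densityOne, hasDensity_one_iff_compl, hasDensity_zero_iff]

instance [IsDirectedOrder D] [Nonempty D] : (densityOne D).NeBot := by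
  refine ⟨fun h => ?_⟩
  have h1 : HasDensity (∅ : Set D) 1 := mem_densityOne.1 (by rw [h]; exact mem_bot)
  have h0 : HasDensity (∅ : Set D) 0 := by simp [HasDensity]
  exact one_ne_zero (tendsto_nhds_unique h1 h0)

end Density

lemma ncard_Iic_nat (n : ℕ) : ((Set.Iic n).ncard : ℝ) = n + 1 := by
  rw [← Finset.coe_Iic, Set.ncard_coe_finset, Nat.card_Iic]
  push_cast
  rfl

lemma densityOne_nat_le_atTop : densityOne ℕ ≤ atTop := by
  refine atTop_basis.ge_iff.2 fun m _ => ?_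
  rw [mem_densityOne_iff]
  intro η hη
  obtain ⟨N, hN⟩ := exists_nat_ge ((m : ℝ) / η)
  filter_upwards [eventually_ge_atTop N] with n hn
  rw [ncard_Iic_nat]
  have h1 : (((Set.Ici m)ᶜ ∩ Set.Iic n).ncard : ℝ) ≤ m := by
    have : (Set.Ici m)ᶜ ∩ Set.Iic n ⊆ ((Finset.range m : Finset ℕ) : Set ℕ) := by
      intro i hi
      simpa using hi.1
    have h := Set.ncard_le_ncard this (Finset.finite_toSet _)
    rw [Set.ncard_coe_finset, Finset.card_range] at h
    exact_mod_cast h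
  have h2 : (N : ℝ) ≤ n := by exact_mod_cast hn
  rw [div_le_iff₀ hη] at hN
  nlinarith

lemma prod_mem_densityOne {A B : Set ℕ} (hA : A ∈ densityOne ℕ) (hB : B ∈ densityOne ℕ) :
    A ×ˢ B ∈ densityOne (ℕ × ℕ) := by
  have h := (Tendsto.comp hA (tendsto_fst (f := (atTop : Filter ℕ)) (g := (atTop : Filter ℕ)))).mul
    (Tendsto.comp hB tendsto_snd)
  rw [prod_atTop_atTop_eq, one_mul] at h
  refine h.congr fun q => ?_
  obtain ⟨m, n⟩ := q
  rw [← Set.Iic_prod_Iic, Set.prod_inter_prod, Set.ncard_prod, Set.ncard_prod]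
  push_cast
  simp only [Function.comp]
  rw [div_mul_div_comm]

lemma densityOne_nat_prod_le_atTop : densityOne (ℕ × ℕ) ≤ atTop := by
  refine atTop_basis.ge_iff.2 fun q _ => ?_
  rw [← Prod.mk.eta (p := q), ← Set.Ici_prod_Ici]
  exact prod_mem_densityOne (densityOne_nat_le_atTop (Ici_mem_atTop _))
    (densityOne_nat_le_atTop (Ici_mem_atTop _))

/-- A decreasing sequence of sets of density one can be diagonalized: some set of density one
is, beyond finitely many elements, contained in each of them. On the stretch where `τ = t` the
exceptional set is contained in that of `A t`, which by then has small relative size. -/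
lemma exists_diagonal_mem_densityOne {A : ℕ → Set ℕ} (hA : Antitone A)
    (h : ∀ t, A t ∈ densityOne ℕ) :
    ∃ τ : ℕ → ℕ, Monotone τ ∧ Tendsto τ atTop atTop ∧ {i | i ∈ A (τ i)} ∈ densityOne ℕ := by
  have hex : ∀ t : ℕ, ∃ N : ℕ, ∀ n ≥ N,
      (((A t)ᶜ ∩ Set.Iic n).ncard : ℝ) ≤ 1 / ((t : ℝ) + 1) * (Set.Iic n).ncard := fun t =>
    eventually_atTop.1 (mem_densityOne_iff.1 (h t) _ Nat.one_div_pos_of_nat)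
  choose N hN using hex
  -- `τ i` is the last `t ≤ i` whose threshold `N t` has been passed, and `0` if there is none
  refine ⟨fun i => Nat.findGreatest (fun t => N t ≤ i) i, ?_, ?_, ?_⟩
  · intro i j hij
    exact Nat.findGreatest_mono (fun t ht => le_trans ht hij) hij
  · refine tendsto_atTop.2 fun t => ?_
    filter_upwards [eventually_ge_atTop (max t (N t))] with i hi
    exact Nat.le_findGreatest (le_trans (le_max_left _ _) hi) (le_trans (le_max_right _ _) hi)
  · rw [mem_densityOne_iff]
    intro η hη
    obtain ⟨t, ht⟩ := exists_nat_one_div_lt hη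
    filter_upwards [eventually_ge_atTop (max t (N t))] with n hn
    set s := Nat.findGreatest (fun t => N t ≤ n) n with hs
    have hts : t ≤ s :=
      Nat.le_findGreatest (le_trans (le_max_left _ _) hn) (le_trans (le_max_right _ _) hn)
    have hNs : N s ≤ n :=
      Nat.findGreatest_spec (P := fun t => N t ≤ n) (le_trans (le_max_left _ _) hn)
        (le_trans (le_max_right _ _) hn)
    have hsub : {i | i ∈ A (Nat.findGreatest (fun t => N t ≤ i) i)}ᶜ ∩ Set.Iic n ⊆
        (A s)ᶜ ∩ Set.Iic n := by
      rintro i ⟨hi, hin⟩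
      refine ⟨fun his => hi (hA ?_ his), hin⟩
      exact Nat.findGreatest_mono (fun t ht => le_trans ht hin) hin
    have h1 : (({i | i ∈ A (Nat.findGreatest (fun t => N t ≤ i) i)}ᶜ ∩ Set.Iic n).ncard : ℝ) ≤
        ((A s)ᶜ ∩ Set.Iic n).ncard := by
      exact_mod_cast Set.ncard_le_ncard hsub ((Set.finite_Iic n).inter_of_right _)
    have h2 : 1 / ((s : ℝ) + 1) ≤ 1 / ((t : ℝ) + 1) := by
      have : (t : ℝ) ≤ s := by exact_mod_cast hts
      gcongr
    calc _ ≤ _ := h1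
      _ ≤ _ := hN s n hNs
      _ ≤ _ := by gcongr; linarith

/-- A set `K` of pairs of density one links any two members of some set `A ⊆ ℕ` of density one by
three pairs `(i, j)`, `(j, j')`, `(i', j')` of `K`. Members of `A` are those whose row in `K` is
dense at some large scale: the product of two such rows is too large to lie in the complement of
`K`. -/
lemma exists_densityOne_pairwise_linked {K : Set (ℕ × ℕ)} (hK : K ∈ densityOne (ℕ × ℕ)) :
    ∃ A ∈ densityOne ℕ, ∀ i ∈ A, ∀ i' ∈ A,
      ∃ j j', (i, j) ∈ K ∧ (j, j') ∈ K ∧ (i', j') ∈ K := by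
  classical
  have hbox : ∀ η : ℝ, 0 < η → ∃ N₀ : ℕ, ∀ M ≥ N₀, ∀ N ≥ N₀,
      ((((Finset.Iic M ×ˢ Finset.Iic N).filter (· ∉ K)).card : ℕ) : ℝ)
        ≤ η * ((M + 1) * (N + 1)) := by
    intro η hη
    obtain ⟨⟨a, b⟩, hab⟩ := eventually_atTop.1 (mem_densityOne_iff.1 hK η hη)
    refine ⟨max a b, fun M hM N hN => ?_⟩
    have h := hab (M, N) ⟨le_trans (le_max_left _ _) hM, le_trans (le_max_right _ _) hN⟩
    rw [← Set.Iic_prod_Iic, Set.ncard_prod, Nat.cast_mul, ncard_Iic_nat, ncard_Iic_nat] at h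
    have he : Kᶜ ∩ Set.Iic M ×ˢ Set.Iic N =
        (((Finset.Iic M ×ˢ Finset.Iic N).filter (· ∉ K) : Finset (ℕ × ℕ)) : Set (ℕ × ℕ)) := by
      ext q
      simp [Prod.le_def, and_comm]
    rwa [he, Set.ncard_coe_finset] at h
  obtain ⟨N₀, hN₀⟩ := hbox (1 / 8) (by norm_num)
  -- `i` is kept if at least three quarters of its row lies in `K` at some scale `M ≥ N₀`; since
  -- `(3 / 4) ^ 2 > 1 / 8`, two such rows have a product that meets `K`
  refine ⟨{i | ∃ M ≥ N₀, (((Finset.Iic M).filter fun j => (i, j) ∉ K).card : ℝ) ≤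
    (M + 1) / 4}, ?_, ?_⟩
  · rw [mem_densityOne_iff]
    intro η hη
    obtain ⟨N₁, hN₁⟩ := hbox (η / 4) (by positivity)
    filter_upwards [eventually_ge_atTop N₁] with n hn
    set M := max N₀ N₁ with hM
    set B := (Finset.Iic n).filter fun i =>
      ((M : ℝ) + 1) / 4 ≤ (((Finset.Iic M).filter fun j => (i, j) ∉ K).card : ℝ) with hB
    have hsub : {i | ∃ M ≥ N₀, (((Finset.Iic M).filter fun j => (i, j) ∉ K).card : ℝ) ≤
        (M + 1) / 4}ᶜ ∩ Set.Iic n ⊆ (B : Set ℕ) := by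
      rintro i ⟨hi, hin⟩
      simp only [hB, Finset.coe_filter, Finset.mem_Iic, Set.mem_ofPred_eq]
      refine ⟨hin, ?_⟩
      by_contra hlt
      exact hi ⟨M, le_max_left _ _, (not_le.1 hlt).le⟩
    have h1 := Set.ncard_le_ncard hsub (Finset.finite_toSet _)
    rw [Set.ncard_coe_finset] at h1
    -- each `i ∈ B` misses at least a quarter of its row, and few pairs are missing in all
    have hfib : ∑ i ∈ B, ((Finset.Iic M).filter fun j => (i, j) ∉ K).card ≤
        ((Finset.Iic n ×ˢ Finset.Iic M).filter (· ∉ K)).card := by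
      rw [← Finset.card_sigma]
      refine Finset.card_le_card_of_injOn (fun x => (x.1, x.2)) ?_ ?_
      · rintro ⟨i, j⟩ hij
        simp only [Finset.coe_sigma, Set.mem_sigma_iff, Finset.mem_coe, Finset.mem_filter,
          hB] at hij
        simp only [Finset.coe_filter, Finset.mem_product, Set.mem_ofPred_eq]
        exact ⟨⟨hij.1.1, hij.2.1⟩, hij.2.2⟩
      · rintro ⟨i, j⟩ _ ⟨i', j'⟩ _ h
        simp only [Prod.mk.injEq] at h
        obtain ⟨rfl, rfl⟩ := h
        rfl
    have h2 : (B.card : ℝ) * (((M : ℝ) + 1) / 4) ≤ η / 4 * ((n + 1) * (M + 1)) := by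
      calc (B.card : ℝ) * (((M : ℝ) + 1) / 4) = ∑ i ∈ B, ((M : ℝ) + 1) / 4 := by simp
        _ ≤ ∑ i ∈ B, (((Finset.Iic M).filter fun j => (i, j) ∉ K).card : ℝ) :=
          Finset.sum_le_sum fun i hi => (Finset.mem_filter.1 hi).2
        _ ≤ (((Finset.Iic n ×ˢ Finset.Iic M).filter (· ∉ K)).card : ℝ) := by exact_mod_cast hfib
        _ ≤ _ := hN₁ n hn M (le_max_right _ _)
    rw [ncard_Iic_nat]
    have h3 : (B.card : ℝ) ≤ η * (n + 1) := by
      have hMpos : (0 : ℝ) < M + 1 := by positivity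
      refine le_of_mul_le_mul_right ?_ hMpos
      linarith
    exact le_trans (by exact_mod_cast h1) h3
  · rintro i ⟨M, hM, hi⟩ i' ⟨M', hM', hi'⟩
    by_contra hcon
    push Not at hcon
    set J := (Finset.Iic M).filter fun j => (i, j) ∈ K with hJ
    set J' := (Finset.Iic M').filter fun j => (i', j) ∈ K with hJ'
    have hsub : J ×ˢ J' ⊆ (Finset.Iic M ×ˢ Finset.Iic M').filter (· ∉ K) := by
      rintro ⟨j, j'⟩ h
      simp only [hJ, hJ', Finset.mem_product, Finset.mem_filter] at h ⊢
      exact ⟨⟨h.1.1, h.2.1⟩, fun hjj => hcon j j' h.1.2 hjj h.2.2⟩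
    have h1 := Finset.card_le_card hsub
    rw [Finset.card_product] at h1
    have h2 := hN₀ M hM M' hM'
    have hc : (J.card : ℝ) + ((Finset.Iic M).filter fun j => (i, j) ∉ K).card = M + 1 := by
      have := Finset.card_filter_add_card_filter_not (s := Finset.Iic M) (fun j => (i, j) ∈ K)
      rw [Nat.card_Iic] at this
      exact_mod_cast this
    have hc' : (J'.card : ℝ) + ((Finset.Iic M').filter fun j => (i', j) ∉ K).card = M' + 1 := by
      have := Finset.card_filter_add_card_filter_not (s := Finset.Iic M') (fun j => (i', j) ∈ K)
      rw [Nat.card_Iic] at this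
      exact_mod_cast this
    have h3 : ((M : ℝ) + 1) * (3 / 4) * ((M' + 1) * (3 / 4)) ≤ J.card * J'.card := by
      gcongr <;> linarith
    have h4 : (J.card : ℝ) * J'.card ≤ 1 / 8 * ((M + 1) * (M' + 1)) :=
      le_trans (by exact_mod_cast h1) h2
    have h5 : (0 : ℝ) < (M + 1) * (M' + 1) := by positivity
    linarith

/-! ### Lattice inequalities -/

section Lattice

variable {E : Type u} [Lattice E] [AddCommGroup E] [IsOrderedAddMonoid E]

lemma abs_inf_le_abs_inf (a w : E) : |a| ⊓ w ≤ |a ⊓ w| := by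
  let _ := AddCommGroup.toDistribLattice E
  have h : |a| ⊓ w = (a ⊓ w) ⊔ (-a ⊓ w) := inf_sup_right a (-a) w
  rw [h]
  refine sup_le (le_abs_self _) ?_
  exact inf_le_left.trans ((neg_le_neg inf_le_left).trans (neg_le_abs _))

lemma add_inf_le_inf_add_inf {a b w : E} (ha : 0 ≤ a) (hb : 0 ≤ b) (hw : 0 ≤ w) :
    (a + b) ⊓ w ≤ a ⊓ w + b ⊓ w := by
  rw [add_inf, inf_add, inf_add]
  refine le_inf (le_inf inf_le_left ?_) (le_inf ?_ ?_)
  · exact inf_le_right.trans (le_add_of_nonneg_right hb)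
  · exact inf_le_right.trans (le_add_of_nonneg_left ha)
  · exact inf_le_right.trans (le_add_of_nonneg_left hw)

lemma abs_inf_sub_inf_le_abs_sub_inf {a b w : E} (ha : 0 ≤ a) (hb : 0 ≤ b) (hw : 0 ≤ w) :
    |a ⊓ w - b ⊓ w| ≤ |a - b| ⊓ w := by
  refine le_inf (abs_inf_sub_inf_le_abs _ _ _) (abs_le'.2 ⟨?_, ?_⟩)
  · exact (sub_le_self _ (le_inf hb hw)).trans inf_le_right
  · rw [neg_sub]
    exact (sub_le_self _ (le_inf ha hw)).trans inf_le_right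

/-- The difference `|x - y|`, truncated at `w`, is controlled by the truncation of `x` at `y + w`:
this turns order convergence of the truncations of a sequence into uo-convergence. -/
lemma abs_sub_inf_le_abs_inf_add_sub (x y w : E) : |x - y| ⊓ w ≤ |x ⊓ (y + w) - y| := by
  refine (abs_inf_le_abs_inf _ _).trans_eq ?_
  rw [inf_sub, add_sub_cancel_left]

lemma abs_posPart_sub_posPart_le (x y : E) : |x⁺ - y⁺| ≤ |x - y| :=
  abs_sup_sub_sup_le_abs x y 0

lemma abs_negPart_sub_negPart_le (x y : E) : |x⁻ - y⁻| ≤ |x - y| := by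
  rw [← posPart_neg, ← posPart_neg]
  refine (abs_posPart_sub_posPart_le _ _).trans_eq ?_
  rw [neg_sub_neg, abs_sub_comm]

end Lattice

/-! ### Order convergence along a filter -/

section OrderConvergence

variable {D : Type v} [Preorder D] {E : Type u} [Lattice E] [AddCommGroup E]

/-- Order convergence of a net along a filter `F`: the dominating net need only be decreasing,
with infimum zero, on some member of `F`. The filter `⊤`, whose only member is the whole index set,
gives order convergence, and the filter of sets of density one gives statistical order
convergence. -/
def OrderConvergesAlong (F : Filter D) (x : D → E) (l : E) : Prop :=
  ∃ p : D → E, (∃ K ∈ F, AntitoneOn p K ∧ IsGLB (p '' K) 0) ∧ ∀ a, |x a - l| ≤ p a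

/-- Unbounded order convergence of a net along a filter. -/
def UOConvergesAlong (F : Filter D) (x : D → E) (l : E) : Prop :=
  ∀ w : E, 0 ≤ w → OrderConvergesAlong F (fun a => |x a - l| ⊓ w) 0

lemma orderConvergesAlong_top_iff {x : D → E} {l : E} :
    OrderConvergesAlong ⊤ x l ↔ OrderConvergesTo x l := by
  simp [OrderConvergesAlong, OrderConvergesTo, and_assoc]

lemma uoConvergesAlong_top_iff {x : D → E} {l : E} :
    UOConvergesAlong ⊤ x l ↔ UOConvergesTo x l := by
  simp only [UOConvergesAlong, UOConvergesTo, orderConvergesAlong_top_iff]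

lemma uoConvergesAlong_densityOne_iff [LocallyFiniteOrderBot D] {x : D → E} {l : E} :
    UOConvergesAlong (densityOne D) x l ↔ StatUOConvergesTo x l := Iff.rfl

lemma OrderConvergesAlong.mono_filter {F G : Filter D} (hFG : F ≤ G) {x : D → E} {l : E}
    (h : OrderConvergesAlong G x l) : OrderConvergesAlong F x l := by
  obtain ⟨p, ⟨K, hK, hp⟩, hx⟩ := h
  exact ⟨p, ⟨K, hFG hK, hp⟩, hx⟩

lemma UOConvergesAlong.mono_filter {F G : Filter D} (hFG : F ≤ G) {x : D → E} {l : E}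
    (h : UOConvergesAlong G x l) : UOConvergesAlong F x l :=
  fun w hw => (h w hw).mono_filter hFG

lemma OrderConvergesAlong.of_abs_le {F : Filter D} {x y : D → E} {l m : E}
    (h : OrderConvergesAlong F x l) (hy : ∀ a, |y a - m| ≤ |x a - l|) :
    OrderConvergesAlong F y m := by
  obtain ⟨p, hp, hx⟩ := h
  exact ⟨p, hp, fun a => (hy a).trans (hx a)⟩

lemma UOConvergesAlong.of_abs_le [IsOrderedAddMonoid E] {F : Filter D} {x y : D → E} {l m : E}
    (h : UOConvergesAlong F x l) (hy : ∀ a, |y a - m| ≤ |x a - l|) :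
    UOConvergesAlong F y m := by
  intro w hw
  refine (h w hw).of_abs_le fun a => ?_
  rw [sub_zero, sub_zero, abs_of_nonneg (le_inf (abs_nonneg _) hw),
    abs_of_nonneg (le_inf (abs_nonneg _) hw)]
  exact inf_le_inf_right _ (hy a)

end OrderConvergence

/-! ### Order convergence and norm convergence -/

section OrderContinuous

lemma exists_mem_ge_of_neBot {D : Type v} [Preorder D] {K : Set D}
    [h : (atTop ⊓ 𝓟 K).NeBot] (a : D) : ∃ k ∈ K, a ≤ k := by
  obtain ⟨k, hk, hkK⟩ := (inf_principal_neBot_iff.1 h) _ (Ici_mem_atTop a)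
  exact ⟨k, hkK, hk⟩

variable {E : Type u} [NormedAddCommGroup E] [Lattice E]

/-- The directed set `K` is lifted to the universe of `E`, as the definition of an order continuous
norm requires. -/
lemma IsOrderContinuousNorm.tendsto_of_isGLB (hE : IsOrderContinuousNorm E) {D : Type}
    [Preorder D] [IsDirectedOrder D] [Nonempty D] {K : Set D} {p : D → E}
    [(atTop ⊓ 𝓟 K).NeBot] (hp : AntitoneOn p K) (h : IsGLB (p '' K) 0) :
    Tendsto p (atTop ⊓ 𝓟 K) (𝓝 0) := by
  have : IsDirectedOrder (ULift.{u} K) := ⟨fun a b => by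
    obtain ⟨c, hac, hbc⟩ := exists_ge_ge (a.down : D) b.down
    obtain ⟨k, hk, hck⟩ := exists_mem_ge_of_neBot (K := K) c
    exact ⟨⟨⟨k, hk⟩⟩, hac.trans hck, hbc.trans hck⟩⟩
  have : Nonempty (ULift.{u} K) := by
    obtain ⟨k, hk, -⟩ := exists_mem_ge_of_neBot (K := K) (Classical.arbitrary D)
    exact ⟨⟨⟨k, hk⟩⟩⟩
  have hlim := hE (ULift.{u} K) (fun k => p k.down) (fun a b hab => hp a.down.2 b.down.2 hab) (by
    convert h using 1
    ext y
    constructor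
    · rintro ⟨k, rfl⟩
      exact ⟨k.down, k.down.2, rfl⟩
    · rintro ⟨k, hk, rfl⟩
      exact ⟨⟨⟨k, hk⟩⟩, rfl⟩)
  refine Metric.tendsto_nhds.2 fun ε hε => ?_
  obtain ⟨k, hk⟩ := eventually_atTop.1 (hlim.eventually (eventually_lt_nhds hε))
  filter_upwards [mem_inf_of_left (Ici_mem_atTop (k.down : D)),
    mem_inf_of_right (mem_principal_self K)] with j hj hjK
  rw [dist_zero_right]
  exact hk ⟨⟨j, hjK⟩⟩ hj

variable [HasSolidNorm E]

lemma tendsto_zero_of_abs_le {α : Type*} {L : Filter α} {f p : α → E} (hp : Tendsto p L (𝓝 0))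
    (h : ∀ᶠ a in L, |f a| ≤ p a) : Tendsto f L (𝓝 0) := by
  refine squeeze_zero_norm' ?_ (tendsto_zero_iff_norm_tendsto_zero.1 hp)
  filter_upwards [h] with a ha
  exact norm_le_norm_of_abs_le_abs (ha.trans (le_abs_self _))

variable [IsOrderedAddMonoid E]

lemma norm_le_norm_of_nonneg_of_le {a b : E} (ha : 0 ≤ a) (hab : a ≤ b) : ‖a‖ ≤ ‖b‖ :=
  norm_le_norm_of_abs_le_abs (by rwa [abs_of_nonneg ha, abs_of_nonneg (ha.trans hab)])

lemma eq_zero_of_forall_nsmul_le [NormedSpace ℝ E] {z b : E} (hz : 0 ≤ z)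
    (h : ∀ k : ℕ, k • z ≤ b) : z = 0 := by
  by_contra hne
  obtain ⟨k, hk⟩ := exists_nat_gt (‖b‖ / ‖z‖)
  rw [div_lt_iff₀ (norm_pos_iff.2 hne)] at hk
  have h1 := norm_le_norm_of_nonneg_of_le (nsmul_nonneg hz k) (h k)
  rw [← Nat.cast_smul_eq_nsmul ℝ, norm_smul, Real.norm_natCast] at h1
  exact absurd h1 (not_le.2 hk)

lemma isGLB_image_of_tendsto {D : Type v} [Preorder D] {K : Set D} {p : D → E}
    [(atTop ⊓ 𝓟 K).NeBot] (hp : AntitoneOn p K) (h : Tendsto p (atTop ⊓ 𝓟 K) (𝓝 0)) :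
    IsGLB (p '' K) 0 := by
  constructor
  · rintro _ ⟨k, hk, rfl⟩
    refine le_of_tendsto h ?_
    filter_upwards [mem_inf_of_left (Ici_mem_atTop k), mem_inf_of_right (mem_principal_self K)]
      with j hj hjK
    exact hp hk hjK hj
  · intro z hz
    refine ge_of_tendsto h ?_
    filter_upwards [mem_inf_of_right (mem_principal_self K)] with j hjK
    exact hz ⟨j, hjK, rfl⟩

/-- When the norm is order continuous, the dominating nets in the definition of order convergence
are exactly the decreasing nets that are null in norm. -/
lemma IsOrderContinuousNorm.orderConvergesAlong_iff (hE : IsOrderContinuousNorm E) {D : Type}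
    [Preorder D] [IsDirectedOrder D] [Nonempty D] {F : Filter D} [hF : (atTop ⊓ F).NeBot]
    {x : D → E} {l : E} :
    OrderConvergesAlong F x l ↔ ∃ p : D → E, (∃ K ∈ F, AntitoneOn p K ∧
      Tendsto p (atTop ⊓ 𝓟 K) (𝓝 0)) ∧ ∀ a, |x a - l| ≤ p a := by
  have hne : ∀ K ∈ F, (atTop ⊓ 𝓟 K).NeBot := fun K hK =>
    hF.mono (inf_le_inf_left _ (le_principal_iff.2 hK))
  constructor
  · rintro ⟨p, ⟨K, hK, hp, h⟩, hx⟩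
    have := hne K hK
    exact ⟨p, ⟨K, hK, hp, hE.tendsto_of_isGLB hp h⟩, hx⟩
  · rintro ⟨p, ⟨K, hK, hp, h⟩, hx⟩
    have := hne K hK
    exact ⟨p, ⟨K, hK, hp, isGLB_image_of_tendsto hp h⟩, hx⟩

lemma OrderConvergesAlong.tendsto (hE : IsOrderContinuousNorm E) {D : Type}
    [Preorder D] [IsDirectedOrder D] [Nonempty D] {F : Filter D} [(atTop ⊓ F).NeBot]
    {x : D → E} {l : E} (h : OrderConvergesAlong F x l) : Tendsto x (atTop ⊓ F) (𝓝 l) := by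
  obtain ⟨p, ⟨K, hK, -, hp⟩, hx⟩ := hE.orderConvergesAlong_iff.1 h
  rw [← tendsto_sub_nhds_zero_iff]
  exact tendsto_zero_of_abs_le (hp.mono_left (inf_le_inf_left _ (le_principal_iff.2 hK)))
    (Eventually.of_forall hx)

lemma OrderConvergesAlong.of_abs_le_add (hE : IsOrderContinuousNorm E) {D : Type}
    [Preorder D] [IsDirectedOrder D] [Nonempty D] {F : Filter D} [(atTop ⊓ F).NeBot]
    {x y z : D → E} {l m c : E} (hx : OrderConvergesAlong F x l) (hy : OrderConvergesAlong F y m)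
    (hz : ∀ a, |z a - c| ≤ |x a - l| + |y a - m|) : OrderConvergesAlong F z c := by
  obtain ⟨p, ⟨K, hK, hp, hp0⟩, hxp⟩ := hE.orderConvergesAlong_iff.1 hx
  obtain ⟨q, ⟨L, hL, hq, hq0⟩, hyq⟩ := hE.orderConvergesAlong_iff.1 hy
  refine hE.orderConvergesAlong_iff.2 ⟨p + q, ⟨K ∩ L, inter_mem hK hL, ?_, ?_⟩, fun a =>
    (hz a).trans (add_le_add (hxp a) (hyq a))⟩
  · exact fun a ha b hb hab => add_le_add (hp ha.1 hb.1 hab) (hq ha.2 hb.2 hab)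
  · have h1 := hp0.mono_left
      (inf_le_inf_left atTop (principal_mono.2 (Set.inter_subset_left (t := L))))
    have h2 := hq0.mono_left
      (inf_le_inf_left atTop (principal_mono.2 (Set.inter_subset_right (s := K))))
    have h3 := h1.add h2
    rw [add_zero] at h3
    exact h3

/-- A sequence with `|a i - a j| ≤ q i` for `i ≤ j` in `K`, where `q` decreases to zero along `K`,
converges in order: its norm limit along `K` satisfies the limiting inequality `|a i - l| ≤ q i`. -/
lemma exists_orderConvergesAlong_of_cauchy [CompleteSpace E] (hE : IsOrderContinuousNorm E)
    {F : Filter ℕ} [hF : (atTop ⊓ F).NeBot] {a q : ℕ → E} {K : Set ℕ} (hK : K ∈ F)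
    (hq : AntitoneOn q K) (hq0 : Tendsto q (atTop ⊓ 𝓟 K) (𝓝 0))
    (ha : ∀ i ∈ K, ∀ j ∈ K, i ≤ j → |a i - a j| ≤ q i) :
    ∃ l, OrderConvergesAlong F a l := by
  classical
  have hne : (atTop ⊓ 𝓟 K).NeBot := hF.mono (inf_le_inf_left _ (le_principal_iff.2 hK))
  have hcauchy : Cauchy (map a (atTop ⊓ 𝓟 K)) := by
    refine Metric.cauchy_iff.2 ⟨inferInstance, fun ε hε => ?_⟩
    have hmem : K ∈ atTop ⊓ 𝓟 K := mem_inf_of_right (mem_principal_self K)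
    obtain ⟨k, hkq, hkK⟩ :=
      ((Metric.tendsto_nhds.1 hq0 (ε / 2) (half_pos hε)).and hmem).exists
    rw [dist_zero_right] at hkq
    have hclose : ∀ i ∈ K ∩ Set.Ici k, dist (a k) (a i) < ε / 2 := by
      rintro i ⟨hiK, hi⟩
      rw [dist_eq_norm]
      exact (norm_le_norm_of_abs_le_abs
        ((ha k hkK i hiK hi).trans (le_abs_self _))).trans_lt hkq
    refine ⟨a '' (K ∩ Set.Ici k), image_mem_map
      (inter_mem hmem (mem_inf_of_left (Ici_mem_atTop k))), ?_⟩
    rintro _ ⟨i, hi, rfl⟩ _ ⟨j, hj, rfl⟩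
    calc dist (a i) (a j) ≤ dist (a k) (a i) + dist (a k) (a j) := dist_triangle_left _ _ _
      _ < ε / 2 + ε / 2 := add_lt_add (hclose i hi) (hclose j hj)
      _ = ε := add_halves ε
  obtain ⟨l, hl⟩ := CompleteSpace.complete hcauchy
  have hl : Tendsto a (atTop ⊓ 𝓟 K) (𝓝 l) := hl
  have hbound : ∀ i ∈ K, |a i - l| ≤ q i := by
    intro i hi
    have hcont : Tendsto (fun j => |a i - a j|) (atTop ⊓ 𝓟 K) (𝓝 |a i - l|) := by
      have h1 : Tendsto (fun j => a i - a j) (atTop ⊓ 𝓟 K) (𝓝 (a i - l)) := hl.const_sub _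
      exact h1.sup_nhds h1.neg
    refine le_of_tendsto hcont ?_
    filter_upwards [mem_inf_of_left (Ici_mem_atTop i), mem_inf_of_right (mem_principal_self K)]
      with j hj hjK
    exact ha i hi j hjK hj
  -- the order bound must hold at every index, so off `K` the difference itself is taken
  have heq : Set.EqOn q (fun i => if i ∈ K then q i else |a i - l|) K := fun i hi => by
    simp [hi]
  refine ⟨l, hE.orderConvergesAlong_iff.2
    ⟨fun i => if i ∈ K then q i else |a i - l|, ⟨K, hK, hq.congr heq, ?_⟩, fun i => ?_⟩⟩
  · refine hq0.congr' ?_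
    filter_upwards [mem_inf_of_right (mem_principal_self K)] with i hi
    exact heq hi
  · by_cases hi : i ∈ K
    · simpa [hi] using hbound i hi
    · simp [hi]

lemma exists_orderConvergesAlong_top [CompleteSpace E] (hE : IsOrderContinuousNorm E)
    {a : ℕ → E} (h : OrderConvergesAlong ⊤ (fun q : ℕ × ℕ => a q.1 - a q.2) 0) :
    ∃ l, OrderConvergesAlong ⊤ a l := by
  have : (atTop ⊓ (⊤ : Filter ℕ)).NeBot := by rw [inf_top_eq]; infer_instance
  have : (atTop ⊓ (⊤ : Filter (ℕ × ℕ))).NeBot := by rw [inf_top_eq]; infer_instance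
  obtain ⟨p, ⟨K, hK, hp, hp0⟩, ha⟩ := hE.orderConvergesAlong_iff.1 h
  obtain rfl := mem_top.1 hK
  refine exists_orderConvergesAlong_of_cauchy hE (q := fun i => p (i, i)) univ_mem ?_ ?_ ?_
  · exact fun i _ j _ hij => hp trivial trivial ⟨hij, hij⟩
  · simp only [principal_univ, inf_top_eq] at hp0 ⊢
    refine hp0.comp ?_
    rw [← prod_atTop_atTop_eq]
    exact tendsto_id.prodMk tendsto_id
  · intro i _ j _ hij
    have h1 := ha (i, j)
    rw [sub_zero] at h1
    exact h1.trans (hp trivial trivial ⟨le_rfl, hij⟩)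

/-- Statistically order Cauchy sequences converge statistically in order. The bound is known only
for pairs in a set of density one in `ℕ × ℕ`; linking indices by paths of pairs above a point `k t`
of that set gives a bound on a set of density one in `ℕ`, and these sets are diagonalized over `t`. -/
lemma exists_orderConvergesAlong_densityOne [CompleteSpace E] (hE : IsOrderContinuousNorm E)
    {a : ℕ → E}
    (h : OrderConvergesAlong (densityOne (ℕ × ℕ)) (fun q : ℕ × ℕ => a q.1 - a q.2) 0) :
    ∃ l, OrderConvergesAlong (densityOne ℕ) a l := by
  have hne : (atTop ⊓ densityOne ℕ).NeBot := by
    rw [inf_eq_right.2 densityOne_nat_le_atTop]; infer_instance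
  have hne2 : (atTop ⊓ densityOne (ℕ × ℕ)).NeBot := by
    rw [inf_eq_right.2 densityOne_nat_prod_le_atTop]; infer_instance
  obtain ⟨p, ⟨K, hK, hp, hp0⟩, ha⟩ := hE.orderConvergesAlong_iff.1 h
  simp only [sub_zero] at ha
  have hneK : (atTop ⊓ 𝓟 K).NeBot := hne2.mono (inf_le_inf_left _ (le_principal_iff.2 hK))
  -- an increasing sequence in `K` that is cofinal in `ℕ × ℕ`
  have hstep : ∀ c : ℕ × ℕ, ∃ k ∈ K, c ≤ k := fun c => exists_mem_ge_of_neBot c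
  choose g hgK hg using hstep
  let k : ℕ → ℕ × ℕ := fun t => Nat.rec (g 0) (fun t c => g (c ⊔ (t + 1, t + 1))) t
  have hk1 : ∀ t, k (t + 1) = g (k t ⊔ (t + 1, t + 1)) := fun t => rfl
  have hkK : ∀ t, k t ∈ K := by
    rintro (_ | t)
    · exact hgK _
    · exact hgK _
  have hkmono : Monotone k := monotone_nat_of_le_succ fun t => by
    rw [hk1]
    exact le_sup_left.trans (hg _)
  have hkge : ∀ t, (t, t) ≤ k t := by
    rintro (_ | t)
    · exact ⟨Nat.zero_le _, Nat.zero_le _⟩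
    · rw [hk1]
      exact le_sup_right.trans (hg _)
  have hktop : Tendsto k atTop (atTop ⊓ 𝓟 K) := by
    refine tendsto_inf.2 ⟨tendsto_atTop_mono hkge ?_,
      tendsto_principal.2 (Eventually.of_forall hkK)⟩
    rw [← prod_atTop_atTop_eq]
    exact tendsto_id.prodMk tendsto_id
  -- linked pairs of indices above `k t` are within `3 • p (k t)` of each other
  have hex : ∀ t, ∃ A ∈ densityOne ℕ, ∀ i ∈ A, ∀ i' ∈ A, |a i - a i'| ≤ 3 • p (k t) := by
    intro t
    obtain ⟨A, hA, hlink⟩ := exists_densityOne_pairwise_linked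
      (inter_mem hK (densityOne_nat_prod_le_atTop (Ici_mem_atTop (k t))))
    refine ⟨A, hA, fun i hi i' hi' => ?_⟩
    obtain ⟨j, j', ⟨h1, h1'⟩, ⟨h2, h2'⟩, ⟨h3, h3'⟩⟩ := hlink i hi i' hi'
    have b1 := (ha (i, j)).trans (hp (hkK t) h1 h1')
    have b2 := (ha (j, j')).trans (hp (hkK t) h2 h2')
    have b3 := (ha (i', j')).trans (hp (hkK t) h3 h3')
    simp only at b1 b2 b3
    rw [abs_sub_comm] at b3
    calc |a i - a i'| = |(a i - a j) + (a j - a j') + (a j' - a i')| := by congr 1; abel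
      _ ≤ |a i - a j| + |a j - a j'| + |a j' - a i'| :=
        (abs_add_le _ _).trans (add_le_add_left (abs_add_le _ _) _)
      _ ≤ p (k t) + p (k t) + p (k t) := add_le_add (add_le_add b1 b2) b3
      _ = 3 • p (k t) := by abel
  choose A hA hAa using hex
  obtain ⟨τ, hτ, hτtop, hτA⟩ := exists_diagonal_mem_densityOne
    (A := fun t => ⋂ s ∈ Finset.range (t + 1), A s)
    (fun s t hst => Set.biInter_subset_biInter_left fun i hi => by
      have hi := Finset.mem_range.1 hi
      exact Finset.mem_range.2 (by omega))
    (fun t => (biInter_finset_mem _).2 fun s _ => hA s)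
  refine exists_orderConvergesAlong_of_cauchy hE (q := fun i => 3 • p (k (τ i))) hτA ?_ ?_ ?_
  · exact fun i _ j _ hij => nsmul_le_nsmul_right (hp (hkK _) (hkK _) (hkmono (hτ hij))) 3
  · have h1 : Tendsto (fun i => 3 • p (k (τ i))) atTop (𝓝 (3 • 0)) :=
      ((hp0.comp (hktop.comp hτtop)).const_smul 3)
    rw [smul_zero] at h1
    exact h1.mono_left inf_le_left
  · intro i hi j hj hij
    refine hAa (τ i) i ?_ j ?_
    · exact Set.mem_iInter₂.1 hi (τ i) (by simp)
    · exact Set.mem_iInter₂.1 hj (τ i) (by have := hτ hij; simp; omega)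

end OrderContinuous

/-! ### Monotone sequences -/

section Monotone

variable {E : Type u} [NormedAddCommGroup E] [Lattice E]

/-- A KB-space has the monotone convergence property for nets: a monotone net that is not Cauchy
contains an increasing sequence that is not Cauchy. -/
lemma IsKBSpace.exists_tendsto_of_monotone [CompleteSpace E] (h : IsKBSpace E)
    {ι : Type*} [SemilatticeSup ι] [Nonempty ι] {f : ι → E} (hf : Monotone f) {C : ℝ}
    (hC : ∀ i, ‖f i‖ ≤ C) : ∃ l, Tendsto f atTop (𝓝 l) := by
  refine cauchySeq_tendsto_of_complete ?_
  by_contra hnot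
  rw [Metric.cauchySeq_iff'] at hnot
  push Not at hnot
  obtain ⟨ε, hε, hstep⟩ := hnot
  choose g hg hgε using hstep
  let k : ℕ → ι := fun t => Nat.rec (Classical.arbitrary ι) (fun _ c => g c) t
  have hk : Monotone k := monotone_nat_of_le_succ fun t => hg (k t)
  obtain ⟨l, hl⟩ := h (f ∘ k) (Or.inl (hf.comp hk)) ⟨C, fun n => hC _⟩
  obtain ⟨N, hN⟩ := Metric.cauchySeq_iff.1 hl.cauchySeq ε hε
  exact absurd (hN (N + 1) (Nat.le_succ N) N le_rfl) (not_lt.2 (hgε (k N)))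

lemma isKBSpace_of_monotone [IsOrderedAddMonoid E]
    (h : ∀ x : ℕ → E, Monotone x → (∃ C : ℝ, ∀ n, ‖x n‖ ≤ C) → ∃ l, Tendsto x atTop (𝓝 l)) :
    IsKBSpace E := by
  rintro x (hx | hx) hC
  · exact h x hx hC
  · obtain ⟨l, hl⟩ := h (fun n => -x n) (fun m n hmn => neg_le_neg (hx hmn)) (by simpa using hC)
    exact ⟨-l, by simpa using hl.neg⟩

variable [IsOrderedAddMonoid E] [HasSolidNorm E]

/-- Order bounded increasing sequences converge in a Banach lattice with order continuous norm: the
differences between the upper bounds and the terms of the sequence decrease to zero. -/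
lemma IsOrderContinuousNorm.exists_tendsto_of_monotone_of_le [NormedSpace ℝ E] [CompleteSpace E]
    (hE : IsOrderContinuousNorm E) {x : ℕ → E} (hx : Monotone x) {b : E} (hb : ∀ n, x n ≤ b) :
    ∃ l, Tendsto x atTop (𝓝 l) := by
  let U := {u : E // ∀ n, x n ≤ u}
  let f : Uᵒᵈ × ULift.{u} ℕ → E := fun i => (OrderDual.ofDual i.1).1 - x i.2.down
  have hdir : IsDirectedOrder (Uᵒᵈ × ULift.{u} ℕ) := by
    refine ⟨fun i j => ?_⟩
    refine ⟨(OrderDual.toDual ⟨(OrderDual.ofDual i.1).1 ⊓ (OrderDual.ofDual j.1).1, fun n =>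
      le_inf ((OrderDual.ofDual i.1).2 n) ((OrderDual.ofDual j.1).2 n)⟩,
      ⟨max i.2.down j.2.down⟩), ⟨?_, ?_⟩, ⟨?_, ?_⟩⟩
    · exact inf_le_left (a := (OrderDual.ofDual i.1).1)
    · exact le_max_left i.2.down _
    · exact inf_le_right (b := (OrderDual.ofDual j.1).1)
    · exact le_max_right _ j.2.down
  have hne : Nonempty (Uᵒᵈ × ULift.{u} ℕ) := ⟨(OrderDual.toDual ⟨b, hb⟩, ⟨0⟩)⟩
  have hf : Antitone f := fun i j hij => sub_le_sub hij.1 (hx hij.2)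
  have hglb : IsGLB (Set.range f) 0 := by
    constructor
    · rintro _ ⟨i, rfl⟩
      exact sub_nonneg.2 ((OrderDual.ofDual i.1).2 _)
    · intro z hz
      have hz' : ∀ u : U, ∀ n, z ⊔ 0 ≤ u.1 - x n := fun u n =>
        sup_le (hz ⟨(OrderDual.toDual u, ⟨n⟩), rfl⟩) (sub_nonneg.2 (u.2 n))
      -- subtracting `z⁺` from an upper bound of `x` leaves an upper bound
      have hup : ∀ k : ℕ, ∀ n, x n ≤ b - k • (z ⊔ 0) := by
        intro k
        induction k with
        | zero => simpa using hb
        | succ k ih =>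
          intro n
          have h1 := hz' ⟨_, ih⟩ n
          simp only at h1
          rw [succ_nsmul, ← sub_sub]
          exact le_sub_comm.1 h1
      have h0 : z ⊔ 0 = 0 :=
        eq_zero_of_forall_nsmul_le le_sup_right fun k => le_sub_comm.1 (hup k 0)
      exact h0 ▸ le_sup_left
  have hlim := hE _ f hf hglb
  refine cauchySeq_tendsto_of_complete (Metric.cauchySeq_iff'.2 fun ε hε => ?_)
  obtain ⟨⟨u, N⟩, hN⟩ := (hlim.eventually (eventually_lt_nhds hε)).exists
  refine ⟨N.down, fun n hn => ?_⟩
  rw [dist_eq_norm]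
  refine (norm_le_norm_of_nonneg_of_le (sub_nonneg.2 (hx hn)) ?_).trans_lt hN
  exact sub_le_sub_right ((OrderDual.ofDual u).2 n) _

/-- If the increments of a norm bounded increasing sequence come close to dominating `s` arbitrarily
late, then `s = 0`: otherwise adding up such increments would exceed the norm bound. -/
lemma eq_zero_of_forall_exists_norm_sub_inf_le [NormedSpace ℝ E] {x : ℕ → E} (hx : Monotone x)
    {C : ℝ} (hC : ∀ n, ‖x n‖ ≤ C) {s : E} (hs : 0 ≤ s)
    (h : ∀ k, ∃ m ≥ k, ‖s - (x m - x k) ⊓ s‖ ≤ ‖s‖ / 2) : s = 0 := by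
  by_contra hne
  have hpos : 0 < ‖s‖ := norm_pos_iff.2 hne
  have hsum : ∀ J : ℕ, ∃ m, ∃ v : E, 0 ≤ v ∧ v ≤ x m - x 0 ∧
      ‖(J : ℝ) • s - v‖ ≤ J * (‖s‖ / 2) := by
    intro J
    induction J with
    | zero => exact ⟨0, 0, le_rfl, by simp, by simp⟩
    | succ J ih =>
      obtain ⟨k, v, hv, hvx, hvs⟩ := ih
      obtain ⟨m, hm, hmk⟩ := h k
      refine ⟨m, v + (x m - x k) ⊓ s, add_nonneg hv (le_inf (sub_nonneg.2 (hx hm)) hs), ?_, ?_⟩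
      · calc v + (x m - x k) ⊓ s ≤ (x k - x 0) + (x m - x k) := add_le_add hvx inf_le_left
          _ = x m - x 0 := by abel
      · have he : ((J + 1 : ℕ) : ℝ) • s - (v + (x m - x k) ⊓ s) =
            ((J : ℝ) • s - v) + (s - (x m - x k) ⊓ s) := by
          push_cast
          rw [add_smul, one_smul]
          abel
        rw [he]
        push_cast
        linarith [norm_add_le ((J : ℝ) • s - v) (s - (x m - x k) ⊓ s)]
  obtain ⟨J, hJ⟩ := exists_nat_gt (2 * C / (‖s‖ / 2))
  rw [div_lt_iff₀ (half_pos hpos)] at hJ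
  obtain ⟨m, v, hv, hvx, hvs⟩ := hsum J
  have h1 : ‖v‖ ≤ 2 * C := by
    have := norm_le_norm_of_nonneg_of_le hv hvx
    linarith [norm_sub_le (x m) (x 0), hC m, hC 0]
  have h2 : J * ‖s‖ - ‖v‖ ≤ ‖(J : ℝ) • s - v‖ := by
    have := norm_sub_norm_le ((J : ℝ) • s) v
    rwa [norm_smul, Real.norm_natCast] at this
  linarith

/-- Norm bounded increasing sequences are uo-Cauchy: with `s k` the supremum of `(x m - x k) ⊓ w`
over `m`, the net `s (min m n)` dominates `|x m - x n| ⊓ w` and decreases to zero. -/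
lemma IsOrderContinuousNorm.uoCauchy_of_monotone [NormedSpace ℝ E] [CompleteSpace E]
    (hE : IsOrderContinuousNorm E) {x : ℕ → E} (hx : Monotone x) {C : ℝ} (hC : ∀ n, ‖x n‖ ≤ C) :
    IsUOCauchySeq x := by
  intro w hw
  have hmono : ∀ k, Monotone fun m => (x m - x k) ⊓ w := fun k m n hmn =>
    inf_le_inf_right _ (sub_le_sub_right (hx hmn) _)
  have hex : ∀ k, ∃ s, Tendsto (fun m => (x m - x k) ⊓ w) atTop (𝓝 s) := fun k =>
    hE.exists_tendsto_of_monotone_of_le (hmono k) fun m => inf_le_right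
  choose s hs using hex
  have hle : ∀ k m, (x m - x k) ⊓ w ≤ s k := fun k m => (hmono k).ge_of_tendsto (hs k) m
  have hanti : Antitone s := fun k j hkj => le_of_tendsto_of_tendsto' (hs j) (hs k) fun m =>
    inf_le_inf_right _ (sub_le_sub_left (hx hkj) _)
  have hnonneg : ∀ k, 0 ≤ s k := fun k => by
    have := hle k k
    rwa [sub_self, inf_eq_left.2 hw] at this
  obtain ⟨σ', hσ'⟩ := hE.exists_tendsto_of_monotone_of_le (x := fun k => -s k)
    (fun k j hkj => neg_le_neg (hanti hkj)) (b := 0) fun k => neg_nonpos.2 (hnonneg k)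
  have hσ : Tendsto s atTop (𝓝 (-σ')) := by simpa using hσ'.neg
  set σ := -σ'
  have hσ0 : 0 ≤ σ := ge_of_tendsto' hσ hnonneg
  have hσs : ∀ k, σ ≤ s k := fun k => hanti.le_of_tendsto hσ k
  have hσw : σ ≤ w := (hσs 0).trans (le_of_tendsto' (hs 0) fun m => inf_le_right)
  have hzero : σ = 0 := by
    by_contra hne
    refine hne (eq_zero_of_forall_exists_norm_sub_inf_le hx hC hσ0 fun k => ?_)
    have h1 : Tendsto (fun m => (x m - x k) ⊓ σ) atTop (𝓝 σ) := by
      have := (hs k).inf_nhds (tendsto_const_nhds (x := σ))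
      simpa only [inf_assoc, inf_eq_right.2 hσw, inf_eq_right.2 (hσs k)] using this
    have h2 : Tendsto (fun m => ‖σ - (x m - x k) ⊓ σ‖) atTop (𝓝 0) := by
      simpa using (h1.const_sub σ).norm
    obtain ⟨m, hm, hmk⟩ := ((h2.eventually (eventually_le_nhds
      (half_pos (norm_pos_iff.2 hne)))).and (eventually_ge_atTop k)).exists
    exact ⟨m, hmk, hm⟩
  rw [hzero] at hσ
  have hmin : Tendsto (fun q : ℕ × ℕ => min q.1 q.2) atTop atTop :=
    tendsto_atTop.2 fun n => by
      filter_upwards [Ici_mem_atTop (n, n)] with q hq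
      exact le_min hq.1 hq.2
  have hp : Antitone fun q : ℕ × ℕ => s (min q.1 q.2) := fun q r hqr =>
    hanti (min_le_min hqr.1 hqr.2)
  refine ⟨fun q => s (min q.1 q.2), hp, ?_, ?_⟩
  · have hne : ((atTop : Filter (ℕ × ℕ)) ⊓ 𝓟 Set.univ).NeBot := by
      rw [principal_univ, inf_top_eq]; infer_instance
    rw [← Set.image_univ]
    refine isGLB_image_of_tendsto (hp.antitoneOn _) ?_
    rw [principal_univ, inf_top_eq]
    exact hσ.comp hmin
  · rintro ⟨m, n⟩
    simp only [sub_zero]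
    rw [abs_of_nonneg (le_inf (abs_nonneg _) hw)]
    rcases le_total m n with hmn | hmn
    · rw [min_eq_left hmn, abs_sub_comm, abs_of_nonneg (sub_nonneg.2 (hx hmn))]
      exact hle m n
    · rw [min_eq_right hmn, abs_of_nonneg (sub_nonneg.2 (hx hmn))]
      exact hle n m

/-- For an increasing sequence even uo-convergence along `F` implies norm convergence: the limit is
an upper bound, so truncating at `l - x 0` changes nothing, and the norms `‖l - x n‖` decrease. -/
lemma UOConvergesAlong.tendsto_of_monotone (hE : IsOrderContinuousNorm E) {F : Filter ℕ}
    [hF : (atTop ⊓ F).NeBot] {x : ℕ → E} (hx : Monotone x) {l : E} (h : UOConvergesAlong F x l) :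
    Tendsto x atTop (𝓝 l) := by
  have hlim : ∀ w, 0 ≤ w → Tendsto (fun n => |x n - l| ⊓ w) (atTop ⊓ F) (𝓝 0) := fun w hw =>
    (h w hw).tendsto hE
  have hle : ∀ k, x k ≤ l := by
    intro k
    have h1 : (x k - l) ⊔ 0 ≤ 0 := by
      refine ge_of_tendsto (hlim ((x k - l) ⊔ 0) le_sup_right) ?_
      filter_upwards [mem_inf_of_left (Ici_mem_atTop k)] with n hn
      refine le_inf (sup_le ?_ (abs_nonneg _)) le_rfl
      exact (sub_le_sub_right (hx hn) _).trans (le_abs_self _)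
    exact sub_nonpos.1 (le_sup_left.trans h1)
  have h2 := hlim (l - x 0) (sub_nonneg.2 (hle 0))
  have h3 : ∀ n, |x n - l| ⊓ (l - x 0) = l - x n := fun n => by
    rw [abs_sub_comm, abs_of_nonneg (sub_nonneg.2 (hle n)), inf_eq_left]
    exact sub_le_sub_left (hx (Nat.zero_le n)) _
  simp only [h3] at h2
  refine Metric.tendsto_atTop.2 fun ε hε => ?_
  obtain ⟨N, hN⟩ := (Metric.tendsto_nhds.1 h2 ε hε).exists
  refine ⟨N, fun n hn => ?_⟩
  rw [dist_zero_right] at hN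
  rw [dist_eq_norm, norm_sub_rev]
  exact (norm_le_norm_of_nonneg_of_le (sub_nonneg.2 (hle n))
    (sub_le_sub_left (hx hn) _)).trans_lt hN

end Monotone

/-! ### Unbounded order completeness of KB-spaces -/

section KB

variable {E : Type u} [NormedAddCommGroup E] [Lattice E] [IsOrderedAddMonoid E] [HasSolidNorm E]
  [CompleteSpace E]

/-- If all the truncations `x n ⊓ w` of a norm bounded positive sequence in a KB-space converge,
then their limits are the truncations `y ⊓ w` of a single `y`. The limits of the truncations form a
norm bounded increasing net indexed by `w`, and `y` is its limit; no weak unit is needed. -/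
lemma IsKBSpace.exists_tendsto_inf (hKB : IsKBSpace E) {L : Filter ℕ} [L.NeBot] {x : ℕ → E}
    {C : ℝ} (hx : ∀ n, 0 ≤ x n) (hC : ∀ᶠ n in L, ‖x n‖ ≤ C)
    (h : ∀ w, 0 ≤ w → ∃ y, Tendsto (fun n => x n ⊓ w) L (𝓝 y)) :
    ∃ y, 0 ≤ y ∧ ∀ w, 0 ≤ w → Tendsto (fun n => x n ⊓ w) L (𝓝 (y ⊓ w)) := by
  choose! Y hY using h
  have hmono : Monotone fun w : Set.Ici (0 : E) => Y w := fun w v hwv =>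
    le_of_tendsto_of_tendsto' (hY w w.2) (hY v v.2) fun n => inf_le_inf_left _ hwv
  have hbound : ∀ w : Set.Ici (0 : E), ‖Y w‖ ≤ C := fun w => by
    refine le_of_tendsto (hY w w.2).norm ?_
    filter_upwards [hC] with n hn
    exact (norm_le_norm_of_nonneg_of_le (le_inf (hx n) w.2) inf_le_left).trans hn
  obtain ⟨y, hy⟩ := hKB.exists_tendsto_of_monotone hmono hbound
  have hYnonneg : ∀ w, 0 ≤ w → 0 ≤ Y w := fun w hw =>
    ge_of_tendsto' (hY w hw) fun n => le_inf (hx n) hw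
  refine ⟨y, ge_of_tendsto' hy fun w => hYnonneg w w.2, fun w hw => ?_⟩
  -- `Y v ⊓ w = Y w` as soon as `w ≤ v`
  have hcut : Tendsto (fun v : Set.Ici (0 : E) => Y v ⊓ w) atTop (𝓝 (Y w)) := by
    refine tendsto_const_nhds.congr' ?_
    filter_upwards [Ici_mem_atTop (⟨w, hw⟩ : Set.Ici (0 : E))] with v hv
    refine tendsto_nhds_unique (hY w hw) ?_
    have h1 := (hY v v.2).inf_nhds (tendsto_const_nhds (x := w))
    have h2 : (v : E) ⊓ w = w := inf_eq_right.2 hv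
    simpa only [inf_assoc, h2] using h1
  rw [tendsto_nhds_unique (hy.inf_nhds (tendsto_const_nhds (x := w))) hcut]
  exact hY w hw

lemma exists_uoConvergesAlong_of_nonneg (hKB : IsKBSpace E) (hE : IsOrderContinuousNorm E)
    {F : Filter ℕ} {G : Filter (ℕ × ℕ)} [(atTop ⊓ F).NeBot]
    (hFG : ∀ a : ℕ → E, OrderConvergesAlong G (fun q : ℕ × ℕ => a q.1 - a q.2) 0 →
      ∃ l, OrderConvergesAlong F a l)
    {x : ℕ → E} {C : ℝ} (hx : ∀ n, 0 ≤ x n)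
    (hC : ∀ᶠ n in atTop ⊓ F, ‖x n‖ ≤ C)
    (h : UOConvergesAlong G (fun q : ℕ × ℕ => x q.1 - x q.2) 0) :
    ∃ l, UOConvergesAlong F x l := by
  have hex : ∀ w, 0 ≤ w → ∃ y, OrderConvergesAlong F (fun n => x n ⊓ w) y := fun w hw => by
    refine hFG _ ((h w hw).of_abs_le fun q => ?_)
    simp only [sub_zero]
    exact (abs_inf_sub_inf_le_abs_sub_inf (hx _) (hx _) hw).trans (le_abs_self _)
  obtain ⟨y, hy, hlim⟩ := hKB.exists_tendsto_inf hx hC fun w hw =>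
    (hex w hw).imp fun z hz => hz.tendsto hE
  refine ⟨y, fun w hw => ?_⟩
  have hyw : 0 ≤ y + w := add_nonneg hy hw
  obtain ⟨z, hz⟩ := hex (y + w) hyw
  have hzy : z = y := by
    rw [tendsto_nhds_unique (hz.tendsto hE) (hlim _ hyw)]
    exact inf_eq_left.2 (le_add_of_nonneg_right hw)
  rw [hzy] at hz
  refine hz.of_abs_le fun n => ?_
  rw [sub_zero, abs_of_nonneg (le_inf (abs_nonneg _) hw)]
  exact abs_sub_inf_le_abs_inf_add_sub _ _ _

/-- In a KB-space, if order Cauchy sequences (along `G`) converge in order (along `F`), then norm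
bounded uo-Cauchy sequences (along `G`) are uo-convergent (along `F`). -/
lemma exists_uoConvergesAlong (hKB : IsKBSpace E) (hE : IsOrderContinuousNorm E)
    {F : Filter ℕ} {G : Filter (ℕ × ℕ)} [(atTop ⊓ F).NeBot]
    (hFG : ∀ a : ℕ → E, OrderConvergesAlong G (fun q : ℕ × ℕ => a q.1 - a q.2) 0 →
      ∃ l, OrderConvergesAlong F a l)
    {x : ℕ → E} {C : ℝ} (hC : ∀ᶠ n in atTop ⊓ F, ‖x n‖ ≤ C)
    (h : UOConvergesAlong G (fun q : ℕ × ℕ => x q.1 - x q.2) 0) :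
    ∃ l, UOConvergesAlong F x l := by
  have hpos : ∀ a : E, ‖a⁺‖ ≤ ‖a‖ := fun a => norm_le_norm_of_abs_le_abs (by
    rw [abs_of_nonneg (posPart_nonneg a)]
    exact sup_le (le_abs_self a) (abs_nonneg a))
  have hneg : ∀ a : E, ‖a⁻‖ ≤ ‖a‖ := fun a => by
    rw [← posPart_neg, ← norm_neg a]
    exact hpos _
  obtain ⟨y, hy⟩ := exists_uoConvergesAlong_of_nonneg hKB hE hFG (x := fun n => (x n)⁺)
    (fun n => posPart_nonneg _) (hC.mono fun n hn => (hpos _).trans hn)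
    (h.of_abs_le fun q => by simpa using abs_posPart_sub_posPart_le (x q.1) (x q.2))
  obtain ⟨z, hz⟩ := exists_uoConvergesAlong_of_nonneg hKB hE hFG (x := fun n => (x n)⁻)
    (fun n => negPart_nonneg _) (hC.mono fun n hn => (hneg _).trans hn)
    (h.of_abs_le fun q => by simpa using abs_negPart_sub_negPart_le (x q.1) (x q.2))
  refine ⟨y - z, fun w hw => (hy w hw).of_abs_le_add hE (hz w hw) fun n => ?_⟩
  have h0 : ∀ a : E, |(|a| ⊓ w)| = |a| ⊓ w := fun a => abs_of_nonneg (le_inf (abs_nonneg _) hw)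
  simp only [sub_zero, h0]
  refine (inf_le_inf_right w ?_).trans
    (add_inf_le_inf_add_inf (abs_nonneg ((x n)⁺ - y)) (abs_nonneg ((x n)⁻ - z)) hw)
  calc |x n - (y - z)| = |((x n)⁺ - y) + -((x n)⁻ - z)| := by
        congr 1
        nth_rewrite 1 [← posPart_sub_negPart (x n)]
        abel
    _ ≤ |(x n)⁺ - y| + |(x n)⁻ - z| := by
        rw [← abs_neg ((x n)⁻ - z)]
        exact abs_add_le _ _

end KB

/-! ### The equivalence -/

theorem theorem2p10 {E : Type u} [NormedAddCommGroup E] [NormedSpace ℝ E] [CompleteSpace E]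
    [Lattice E] [IsOrderedAddMonoid E] [IsOrderedModule ℝ E] [HasSolidNorm E]
    (hE : IsOrderContinuousNorm E) :
    List.TFAE [
      IsKBSpace E,
      ∀ x : ℕ → E, (∃ C : ℝ, ∀ n, ‖x n‖ ≤ C) → IsUOCauchySeq x → ∃ l : E, UOConvergesTo x l,
      ∀ x : ℕ → E, IsStatNormBounded x → IsStatUOCauchySeq x →
        ∃ l : E, StatUOConvergesTo x l] := by
  have hneTop : (atTop ⊓ (⊤ : Filter ℕ)).NeBot := by rw [inf_top_eq]; infer_instance
  have hneSt : (atTop ⊓ densityOne ℕ).NeBot := by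
    rw [inf_eq_right.2 densityOne_nat_le_atTop]; infer_instance
  tfae_have 1 → 2 := by
    rintro hKB x ⟨C, hC⟩ hx
    obtain ⟨l, hl⟩ := exists_uoConvergesAlong (F := ⊤) (G := ⊤) hKB hE
      (fun a => exists_orderConvergesAlong_top hE) (Eventually.of_forall hC)
      (uoConvergesAlong_top_iff.2 hx)
    exact ⟨l, uoConvergesAlong_top_iff.1 hl⟩
  tfae_have 2 → 1 := by
    refine fun h => isKBSpace_of_monotone fun x hx ⟨C, hC⟩ => ?_
    obtain ⟨l, hl⟩ := h x ⟨C, hC⟩ (hE.uoCauchy_of_monotone hx hC)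
    exact ⟨l, (uoConvergesAlong_top_iff.2 hl).tendsto_of_monotone hE hx⟩
  tfae_have 1 → 3 := by
    intro hKB x hb hx
    obtain ⟨r, hr, hdens⟩ := hb 1 one_pos
    have hmem : {a | 1 < ‖r • x a‖}ᶜ ∈ densityOne ℕ := by
      rwa [mem_densityOne, hasDensity_one_iff_compl, compl_compl]
    have hC : ∀ᶠ n in atTop ⊓ densityOne ℕ, ‖x n‖ ≤ 1 / r := by
      filter_upwards [mem_inf_of_right hmem] with n hn
      have h1 : ‖r • x n‖ ≤ 1 := not_lt.1 hn
      rw [norm_smul, Real.norm_of_nonneg hr.le] at h1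
      rwa [le_div_iff₀' hr]
    exact exists_uoConvergesAlong hKB hE (fun a => exists_orderConvergesAlong_densityOne hE) hC hx
  tfae_have 3 → 1 := by
    refine fun h => isKBSpace_of_monotone fun x hx ⟨C, hC⟩ => ?_
    have hb : IsStatNormBounded x := by
      intro ε hε
      have hC0 : 0 ≤ C := (norm_nonneg _).trans (hC 0)
      refine ⟨ε / (C + 1), by positivity, ?_⟩
      have hempty : {a | ε < ‖(ε / (C + 1)) • x a‖} = ∅ := by
        refine Set.eq_empty_of_forall_notMem fun n hn => ?_
        have hn : ε < ‖(ε / (C + 1)) • x n‖ := hn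
        rw [norm_smul, Real.norm_of_nonneg (by positivity), div_mul_eq_mul_div,
          lt_div_iff₀ (by positivity)] at hn
        nlinarith [hC n]
      rw [hempty]
      simp [HasDensity]
    obtain ⟨l, hl⟩ := h x hb (uoConvergesAlong_densityOne_iff.1
      ((uoConvergesAlong_top_iff.2 (hE.uoCauchy_of_monotone hx hC)).mono_filter le_top))
    exact ⟨l, UOConvergesAlong.tendsto_of_monotone (F := densityOne ℕ) hE hx hl⟩
  tfae_finish
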